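/- Let $n\ge 1$, $d\ge 2$, $r\ge 2$ be integers. For $\alpha=(\alpha_{i,j})_{1\le i\le r-1,\,0\le j\le n}$ with complex entries let $$F_\alpha=x_0^d+\sum_{i=1}^{r-1}(\alpha_{i,0}x_0+\cdots+\alpha_{i,n}x_n)^d\in\mathbb{C}[x_0,\dots,x_n]_d .$$ Let $\langle\cdot,\cdot\rangle$ be the complex bilinear Bombieri--Weyl product $\langle F,G\rangle=\sum_{|\beta|=d}\binom{d}{\beta}^{-1}F_\beta G_\beta$ on forms of degree $d$ (where $F_\beta,G_\beta$ are the coefficients of $x^\beta$). A linear form $L$ is an eigenvector of $F$ with singular value $\mu\in\mathbb{C}$ if $\langle F-\mu L^d,L^{d-1}M\rangle=0$ for all linear forms $M$, and an eigenvector of $F$ if this holds for some $\mu$. Put $$g_j=\sum_{i=1}^{r-1}\alpha_{i,0}^{d-1}\alpha_{i,j}\quad(1\le j\le n),\qquad g_0'=\sum_{i=1}^{r-1}\alpha_{i,0}^d ,\qquad I=(g_1,\dots,g_n),\quad I'=(g_0',g_1,\dots,g_n).$$ Let $X$ (respectively $X'$) be the set of points $[\alpha]\in\mathbb{P}^{(n+1)(r-1)-1}$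 such that $x_0$ is an eigenvector of $F_\alpha$ (respectively an eigenvector of $F_\alpha$ with singular value $1$). Codimension means the height of the ideal of all polynomials vanishing on the locus, and the degree of a locus with its equations is that of the projective scheme defined by the ideal of these equations (through the Hilbert polynomial). 1. For every $\alpha$, $x_0$ is an eigenvector of $F_\alpha$ if and only if $g_1(\alpha)=\dots=g_n(\alpha)=0$, and it is one with singular value $1$ if and only if moreover $g_0'(\alpha)=0$. Thus $X$ is the zero locus of $I$ and $X'$ is the zero locus of $I'$. 2. If $r\ge n+1$, then $X$ has codimension $n$, and the scheme defined by $I$ has degree $d^n$. If $r\ge n+2$, then moreover $I$ is prime and is the full vanishing ideal of $X$, so that $X$ itself is an irreducible variety of degree $d^n$. In particular, if $n=1$, then $I$ is generated by one nonzero form of degree $d$, and $X$ is a hypersurface, of degree $d$ with the scheme structure defined by $I$. 3. If $r\ge n+2$, then $X'$ has codimension $n+1$, and the scheme defined by $I'$ has degree $d^{n+1}$. If $r\ge n+3$, then moreover $I'$ is prime and is the full vanishing ideal of $X'$, so that $X'$ itself is an irreducible variety of degree $d^{n+1}$. -/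

import Mathlib

open MvPolynomial Filter
open scoped LinearAlgebra.Projectivization

noncomputable section

namespace CriticalWaring

/-- The Bombieri-Weyl product for which the variables are orthonormal:
`⟨F, G⟩ = ∑_α (d choose α)⁻¹ F_α G_α` on forms of degree `d`.
It is complex bilinear, with no conjugation. -/
def bombieriWeyl {σ : Type*} (F G : MvPolynomial σ ℂ) : ℂ :=
  ∑ α ∈ F.support, (α.multinomial : ℂ)⁻¹ * (coeff α F * coeff α G)

/-- The linear form `c_0 x_0 + … + c_n x_n`. -/
def linForm {n : ℕ} (c : Fin (n + 1) → ℂ) : MvPolynomial (Fin (n + 1)) ℂ :=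
  ∑ j, C (c j) * X j

/-- The linear form `L` is an eigenvector of the degree `d` form `F` with singular value `μ`:
`⟨F - μ L^d, L^(d-1) M⟩ = 0` for every linear form `M`. -/
def IsEigenvectorWith {n : ℕ} (d : ℕ) (F L : MvPolynomial (Fin (n + 1)) ℂ) (μ : ℂ) : Prop :=
  ∀ M : MvPolynomial (Fin (n + 1)) ℂ, M.IsHomogeneous 1 →
    bombieriWeyl (F - C μ * L ^ d) (L ^ (d - 1) * M) = 0

/-- The linear form `L` is an eigenvector of the degree `d` form `F`. -/
def IsEigenvector {n : ℕ} (d : ℕ) (F L : MvPolynomial (Fin (n + 1)) ℂ) : Prop :=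
  ∃ μ : ℂ, IsEigenvectorWith d F L μ

/-- The index set of the coordinates `α_{i,j}`, with `r - 1` values of `i` and `j = 0, …, n`. -/
abbrev Idx (n r : ℕ) : Type := Fin (r - 1) × Fin (n + 1)

/-- The form `x_0^d + ∑_i (α_{i,0} x_0 + … + α_{i,n} x_n)^d`, with `r - 1` summands in the sum. -/
def powerSum (n d r : ℕ) (α : Idx n r → ℂ) : MvPolynomial (Fin (n + 1)) ℂ :=
  X 0 ^ d + ∑ i, linForm (fun j => α (i, j)) ^ d

/-- The points `[α]` of the projective space of dimension `(n+1)(r-1) - 1` for which `x_0` is an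
eigenvector of the form with parameters `α`. -/
def eigenLocus (n d r : ℕ) : Set (ℙ ℂ (Idx n r → ℂ)) :=
  {p | IsEigenvector d (powerSum n d r p.rep) (X 0)}

/-- The points `[α]` for which `x_0` is an eigenvector with singular value `1`. -/
def singularLocus (n d r : ℕ) : Set (ℙ ℂ (Idx n r → ℂ)) :=
  {p | IsEigenvectorWith d (powerSum n d r p.rep) (X 0) 1}

/-- `g_j = ∑_i α_{i,0}^(d-1) α_{i,j}`; the indices `j = 1, …, n` are the successors of `Fin n`. -/
def g (n d r : ℕ) (j : Fin n) : MvPolynomial (Idx n r) ℂ :=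
  ∑ i, X (i, 0) ^ (d - 1) * X (i, j.succ)

/-- The additional equation `∑_i α_{i,0}^d`. -/
def gZero (n d r : ℕ) : MvPolynomial (Idx n r) ℂ :=
  ∑ i, X (i, 0) ^ d

/-- The ideal `(g_1, …, g_n)`. -/
def eigenIdeal (n d r : ℕ) : Ideal (MvPolynomial (Idx n r) ℂ) :=
  Ideal.span (Set.range (g n d r))

/-- The ideal generated by `g_1, …, g_n` and `∑_i α_{i,0}^d`. -/
def singularIdeal (n d r : ℕ) : Ideal (MvPolynomial (Idx n r) ℂ) :=
  Ideal.span (insert (gZero n d r) (Set.range (g n d r)))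

/-- The points of projective space at which a homogeneous ideal vanishes. -/
def projZeroLocus {σ : Type*} (I : Ideal (MvPolynomial σ ℂ)) : Set (ℙ ℂ (σ → ℂ)) :=
  {p | ∀ f ∈ I, eval p.rep f = 0}

/-- The ideal of a subset of projective space: all polynomials vanishing at every nonzero vector
which represents a point of the subset. -/
def projVanishingIdeal {σ : Type*} (Z : Set (ℙ ℂ (σ → ℂ))) : Ideal (MvPolynomial σ ℂ) :=
  vanishingIdeal ℂ {v : σ → ℂ | ∃ hv : v ≠ 0, Projectivization.mk ℂ v hv ∈ Z}

/-- The codimension of a closed subset of projective space: the height of its ideal. -/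
def codim {σ : Type*} (Z : Set (ℙ ℂ (σ → ℂ))) : ℕ∞ :=
  (projVanishingIdeal Z).height

/-- The Hilbert function of `S / I` for a homogeneous ideal `I` of a polynomial ring `S`: the
dimension of the image in `S / I` of the forms of degree `k`. -/
def hilbertFunction {σ : Type*} (I : Ideal (MvPolynomial σ ℂ)) (k : ℕ) : ℕ :=
  Module.finrank ℂ
    ((homogeneousSubmodule σ ℂ k).map (Ideal.Quotient.mkₐ ℂ I).toLinearMap)

/-- The projective scheme defined by the homogeneous ideal `I` has degree `δ`: it has a nonzero
Hilbert polynomial, whose leading coefficient is `δ / e!` where `e` is its degree. -/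
def HasDegree {σ : Type*} (I : Ideal (MvPolynomial σ ℂ)) (δ : ℕ) : Prop :=
  ∃ P : Polynomial ℚ, P ≠ 0 ∧
    (∀ᶠ k : ℕ in atTop, (hilbertFunction I k : ℚ) = P.eval (k : ℚ)) ∧
    P.leadingCoeff * (P.natDegree.factorial : ℚ) = (δ : ℚ)

end CriticalWaring

end

/-!
The Bombieri-Weyl product with `x_0^(d-1) x_j` reads off a coefficient, and for a `d`-th power of a
linear form this coefficient is, up to a multinomial factor, a monomial in the coefficients of the
form. This turns the eigenvector conditions into the equations `g_j = 0` and
`∑ α_{i,0}^d = 0` (`isEigenvectorWith_powerSum_iff`).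

Everything else rests on one observation. For a suitable weight on the variables the leading
monomials of the equations are `α_{j-1,0}^(d-1) α_{j-1,j}` (rows numbered from `0`) and
`α_{n,0}^d`, which lie in different rows and so are pairwise coprime. For polynomials `f_j` whose
leading monomials `x ^ e_j` are pairwise coprime (`CoprimeLeads`), the products of powers of the
`f_j` with monomials give one polynomial with leading monomial `x ^ s` for each `s`, hence a basis
of the polynomial ring, on which multiplication by `f_j` acts as the shift by `e_j`. The ideal
generated by some of the `f_j` is spanned by the basis elements with `e_j ≤ s` for one of these `j`
(`CoprimeLeads.mem_span_iff`). Three consequences follow.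

* The `f_j` are a regular sequence in any order, so with Krull's theorem the ideal they generate
  has height the number of the `f_j` (`CoprimeLeads.height_span`).
* The Hilbert function counts the monomials of degree `k` divisible by no `x ^ e_j`. Each further
  equation of degree `d` replaces a function `H k` by `H k - H (k - d)`, which lowers the degree of
  the Hilbert polynomial by one and multiplies the degree of the scheme by `d`
  (`CoprimeLeads.hasDegree_span`).
* A variable which occurs in no leading monomial is a nonzerodivisor modulo the ideal
  (`CoprimeLeads.mem_span_of_X_mul_mem`).

If there is one more row `l`, the last point applies to `α_{l,0}`. After inversion of `α_{l,0}` the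
equations `g_j = 0` can be solved for `α_{l,j}`, and what is left is a localized polynomial ring
over `ℂ[α_{i,0}]` or over its quotient by the Fermat form `∑ α_{i,0}^d`. The latter is prime in at
least three variables by Eisenstein's criterion (`prime_sum_X_pow`), so the ideal is prime
(`isPrime_of_X_mul_mem`). The Nullstellensatz relates the ideals to the loci
(`projVanishingIdeal_projZeroLocus`).
-/

namespace CriticalWaring

/-! ### Multiplicity of a monomial in a monomial -/

section Multiplicity

variable {σ ι : Type*}

open Classical in
/-- The largest `k` for which the monomial `x ^ s` is divisible by `(x ^ e) ^ k`; it is meaningful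
only for `e ≠ 0`. -/
noncomputable def expMultiplicity (e s : σ →₀ ℕ) : ℕ :=
  Nat.findGreatest (fun k => k • e ≤ s) s.degree

lemma le_expMultiplicity_iff {e : σ →₀ ℕ} (he : e ≠ 0) {s : σ →₀ ℕ} {k : ℕ} :
    k ≤ expMultiplicity e s ↔ k • e ≤ s := by
  classical
  constructor
  · intro h
    have h0 : expMultiplicity e s • e ≤ s :=
      Nat.findGreatest_spec (P := fun k => k • e ≤ s) (Nat.zero_le _) (by simp)
    exact (nsmul_le_nsmul_left (zero_le) h).trans h0
  · intro h
    refine Nat.le_findGreatest ?_ h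
    have h1 : (k • e).degree ≤ s.degree := Finsupp.degree_mono h
    have h2 : e.degree ≠ 0 := fun h0 => he ((Finsupp.degree_eq_zero_iff e).1 h0)
    rw [map_nsmul, smul_eq_mul] at h1
    exact (Nat.le_mul_of_pos_right k (Nat.pos_of_ne_zero h2)).trans h1

lemma expMultiplicity_add_self {e : σ →₀ ℕ} (he : e ≠ 0) (s : σ →₀ ℕ) :
    expMultiplicity e (s + e) = expMultiplicity e s + 1 := by
  refine eq_of_forall_le_iff fun k => ?_
  rw [le_expMultiplicity_iff he]
  rcases k with _ | k
  · simp
  · rw [add_le_add_iff_right, le_expMultiplicity_iff he, add_smul, one_smul,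
      add_le_add_iff_right]

lemma nsmul_le_add_iff_of_disjoint {e u : σ →₀ ℕ} (h : Disjoint e.support u.support)
    (s : σ →₀ ℕ) (k : ℕ) : k • e ≤ s + u ↔ k • e ≤ s := by
  refine ⟨fun hk i => ?_, fun hk => hk.trans le_self_add⟩
  by_cases hi : i ∈ e.support
  · have h0 : u i = 0 := by simpa using Finset.disjoint_left.1 h hi
    simpa [h0] using hk i
  · simp [Finsupp.notMem_support_iff.1 hi]

lemma expMultiplicity_add_of_disjoint {e u : σ →₀ ℕ} (he : e ≠ 0)
    (h : Disjoint e.support u.support) (s : σ →₀ ℕ) :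
    expMultiplicity e (s + u) = expMultiplicity e s := by
  refine eq_of_forall_le_iff fun k => ?_
  rw [le_expMultiplicity_iff he, le_expMultiplicity_iff he, nsmul_le_add_iff_of_disjoint h]

/-- At each variable at most one of the coprime monomials contributes to the sum. -/
lemma sum_expMultiplicity_le [Fintype ι] {e : ι → σ →₀ ℕ} (he : ∀ j, e j ≠ 0)
    (hd : Pairwise fun j l => Disjoint (e j).support (e l).support) (s : σ →₀ ℕ) :
    ∑ j, expMultiplicity (e j) s • e j ≤ s := by
  intro i
  rw [Finsupp.finsetSum_apply]
  by_cases h : ∃ j, i ∈ (e j).support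
  · obtain ⟨j, hj⟩ := h
    rw [Finset.sum_eq_single j]
    · exact (le_expMultiplicity_iff (he j)).1 le_rfl i
    · intro l _ hl
      have : i ∉ (e l).support := Finset.disjoint_left.1 (hd hl.symm) hj
      simp [Finsupp.notMem_support_iff.1 this]
    · simp
  · push Not at h
    rw [Finset.sum_eq_zero]
    · exact Nat.zero_le _
    · intro l _
      simp [Finsupp.notMem_support_iff.1 (h l)]

end Multiplicity

/-! ### Leading monomials for a weight -/

section Lead

variable {σ ι K : Type*} [CommRing K]

/-- For the weight `w` on the variables, `p` is the monomial `x ^ s` plus a combination of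
monomials of smaller weight. -/
def HasLead (w : σ → ℕ) (s : σ →₀ ℕ) (p : MvPolynomial σ K) : Prop :=
  p - monomial s 1 ∈ restrictSupport K {u | Finsupp.weight w u < Finsupp.weight w s}

open scoped Pointwise in
lemma mul_mem_restrictSupport {A B T : Set (σ →₀ ℕ)} (h : A + B ⊆ T) {p q : MvPolynomial σ K}
    (hp : p ∈ restrictSupport K A) (hq : q ∈ restrictSupport K B) :
    p * q ∈ restrictSupport K T := by
  refine restrictSupport_mono K h ?_
  rw [restrictSupport_add]
  exact Submodule.mul_mem_mul hp hq

lemma hasLead_monomial (w : σ → ℕ) (s : σ →₀ ℕ) :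
    HasLead w s (monomial s (1 : K)) := by
  simp [HasLead]

lemma HasLead.mul {w : σ → ℕ} {s u : σ →₀ ℕ} {p q : MvPolynomial σ K}
    (hp : HasLead w s p) (hq : HasLead w u q) : HasLead w (s + u) (p * q) := by
  have hs : (monomial s (1 : K)) ∈ restrictSupport K {v | v = s} := by simp
  have hu : (monomial u (1 : K)) ∈ restrictSupport K {v | v = u} := by simp
  have key : p * q - monomial (s + u) 1 = monomial s 1 * (q - monomial u 1) +
      (p - monomial s 1) * monomial u 1 + (p - monomial s 1) * (q - monomial u 1) := by
    have : (monomial (s + u) (1 : K)) = monomial s 1 * monomial u 1 := by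
      rw [monomial_mul, one_mul]
    rw [this]; ring
  unfold HasLead
  rw [key]
  refine add_mem (add_mem ?_ ?_) ?_
  · refine mul_mem_restrictSupport ?_ hs hq
    rintro _ ⟨a, ha, b, hb, rfl⟩
    simp only [Set.mem_ofPred_eq, map_add] at *
    subst ha; lia
  · refine mul_mem_restrictSupport ?_ hp hu
    rintro _ ⟨a, ha, b, hb, rfl⟩
    simp only [Set.mem_ofPred_eq, map_add] at *
    subst hb; lia
  · refine mul_mem_restrictSupport ?_ hp hq
    rintro _ ⟨a, ha, b, hb, rfl⟩
    simp only [Set.mem_ofPred_eq, map_add] at *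
    lia

lemma HasLead.pow {w : σ → ℕ} {s : σ →₀ ℕ} {p : MvPolynomial σ K}
    (hp : HasLead w s p) (k : ℕ) : HasLead w (k • s) (p ^ k) := by
  induction k with
  | zero => simpa using hasLead_monomial (K := K) w 0
  | succ k ih => rw [pow_succ, add_smul, one_smul]; exact ih.mul hp

lemma HasLead.prod {w : σ → ℕ} {s : ι → σ →₀ ℕ} {p : ι → MvPolynomial σ K}
    (hp : ∀ j, HasLead w (s j) (p j)) (J : Finset ι) :
    HasLead w (∑ j ∈ J, s j) (∏ j ∈ J, p j) := by
  classical
  induction J using Finset.induction_on with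
  | empty => simpa using hasLead_monomial (K := K) w 0
  | insert a J ha ih => rw [Finset.sum_insert ha, Finset.prod_insert ha]; exact (hp a).mul ih

/-- If the leading monomials of a family of polynomials are all the monomials, each of them once,
then the family is linearly independent. -/
lemma linearIndependent_of_hasLead {w : σ → ℕ} {v : (σ →₀ ℕ) → MvPolynomial σ K}
    (hv : ∀ s, HasLead w s (v s)) : LinearIndependent K v := by
  rw [linearIndependent_iff]
  classical
  intro l hl
  by_contra hne
  obtain ⟨s, hs, hmax⟩ := Finset.exists_max_image l.support (Finsupp.weight w)
    (Finsupp.support_nonempty_iff.2 hne)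
  have hc : coeff s (Finsupp.linearCombination K v l) = l s := by
    rw [Finsupp.linearCombination_apply, Finsupp.sum, coeff_sum, Finset.sum_eq_single s]
    · have h : coeff s (v s - monomial s 1) = 0 := by
        rw [← notMem_support_iff]
        intro h
        exact lt_irrefl (Finsupp.weight w s) ((mem_restrictSupport_iff K).1 (hv s) h)
      rw [coeff_sub, coeff_monomial, if_pos rfl, sub_eq_zero] at h
      rw [coeff_smul, h, smul_eq_mul, mul_one]
    · intro u hu hus
      have h : coeff s (v u - monomial u 1) = 0 := by
        rw [← notMem_support_iff]
        intro h
        exact absurd ((mem_restrictSupport_iff K).1 (hv u) h) (not_lt.2 (hmax u hu))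
      rw [coeff_sub, coeff_monomial, if_neg hus, sub_zero] at h
      rw [coeff_smul, h, smul_zero]
    · intro h; exact absurd hs h
  rw [hl, coeff_zero] at hc
  exact Finsupp.mem_support_iff.1 hs hc.symm

/-- If the leading monomials of a family of polynomials are all the monomials, each of them once,
then the family spans: subtract a member and induct on the weight. -/
lemma span_eq_top_of_hasLead {w : σ → ℕ} {v : (σ →₀ ℕ) → MvPolynomial σ K}
    (hv : ∀ s, HasLead w s (v s)) : ⊤ ≤ Submodule.span K (Set.range v) := by
  have key : ∀ (N : ℕ) (s : σ →₀ ℕ), Finsupp.weight w s = N →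
      monomial s (1 : K) ∈ Submodule.span K (Set.range v) := by
    intro N
    induction N using Nat.strong_induction_on with
    | _ N ih =>
      intro s hs
      have h1 : restrictSupport K {u | Finsupp.weight w u < Finsupp.weight w s} ≤
          Submodule.span K (Set.range v) := by
        rw [restrictSupport_eq_span, Submodule.span_le]
        rintro _ ⟨u, hu, rfl⟩
        exact ih _ (hs ▸ hu) u rfl
      have h2 := sub_mem (Submodule.subset_span (Set.mem_range_self s)) (h1 (hv s))
      simpa using h2
  intro p _
  rw [p.as_sum]
  refine Submodule.sum_mem _ fun s _ => ?_
  have : monomial s (coeff s p) = coeff s p • monomial s (1 : K) := by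
    rw [smul_monomial, smul_eq_mul, mul_one]
  rw [this]
  exact Submodule.smul_mem _ _ (key _ s rfl)

/-- A family of polynomials whose leading monomials `x ^ e j` for the weight `w` are nontrivial
and pairwise coprime. -/
structure CoprimeLeads (w : σ → ℕ) (e : ι → σ →₀ ℕ) (f : ι → MvPolynomial σ K) : Prop where
  ne_zero : ∀ j, e j ≠ 0
  disjoint : Pairwise fun j l => Disjoint (e j).support (e l).support
  hasLead : ∀ j, HasLead w (e j) (f j)

variable [Fintype ι]

/-- The product of powers of the `f j` and of a monomial, with leading monomial `x ^ s`, in which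
the exponents of the `f j` are as large as possible. -/
noncomputable def mixedMonomial (e : ι → σ →₀ ℕ) (f : ι → MvPolynomial σ K) (s : σ →₀ ℕ) :
    MvPolynomial σ K :=
  (∏ j, f j ^ expMultiplicity (e j) s) * monomial (s - ∑ j, expMultiplicity (e j) s • e j) 1

namespace CoprimeLeads

variable {w : σ → ℕ} {e : ι → σ →₀ ℕ} {f : ι → MvPolynomial σ K} (h : CoprimeLeads w e f)

include h

lemma hasLead_mixedMonomial (s : σ →₀ ℕ) : HasLead w s (mixedMonomial e f s) := by
  have h1 := (HasLead.prod (fun j => (h.hasLead j).pow (expMultiplicity (e j) s))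
    Finset.univ).mul (hasLead_monomial w (s - ∑ j, expMultiplicity (e j) s • e j))
  rwa [add_tsub_cancel_of_le (sum_expMultiplicity_le h.ne_zero h.disjoint s)] at h1

lemma mul_mixedMonomial (l : ι) (s : σ →₀ ℕ) :
    f l * mixedMonomial e f s = mixedMonomial e f (s + e l) := by
  classical
  have hm : ∀ j, expMultiplicity (e j) (s + e l) =
      expMultiplicity (e j) s + if j = l then 1 else 0 := by
    intro j
    split_ifs with hj
    · subst hj; exact expMultiplicity_add_self (h.ne_zero j) s
    · exact expMultiplicity_add_of_disjoint (h.ne_zero j) (h.disjoint hj) s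
  unfold mixedMonomial
  simp only [hm, pow_add, add_smul, Finset.prod_mul_distrib, Finset.sum_add_distrib, ite_smul,
    pow_ite, pow_one, pow_zero, one_smul, zero_smul, Finset.prod_ite_eq', Finset.sum_ite_eq',
    Finset.mem_univ, if_true, add_tsub_add_eq_tsub_right]
  ring

lemma monomial_mul_mixedMonomial {u : σ →₀ ℕ} (hu : ∀ j, Disjoint (e j).support u.support)
    (s : σ →₀ ℕ) :
    monomial u 1 * mixedMonomial e f s = mixedMonomial e f (s + u) := by
  unfold mixedMonomial
  simp only [fun j => expMultiplicity_add_of_disjoint (h.ne_zero j) (hu j) s]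
  rw [mul_left_comm, monomial_mul, one_mul, add_comm u,
    tsub_add_eq_add_tsub (sum_expMultiplicity_le h.ne_zero h.disjoint s)]

/-- The basis of the polynomial ring made of products of powers of the `f j` and monomials. It is
adapted to the ideals generated by subfamilies of `f`: see `mem_span_iff`. -/
noncomputable def basis : Module.Basis (σ →₀ ℕ) K (MvPolynomial σ K) :=
  Module.Basis.mk (linearIndependent_of_hasLead h.hasLead_mixedMonomial)
    (span_eq_top_of_hasLead h.hasLead_mixedMonomial)

@[simp]
lemma basis_apply (s : σ →₀ ℕ) : h.basis s = mixedMonomial e f s := by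
  simp [basis]

/-- The ideal generated by the `f j` with `j ∈ J` is spanned by the basis elements whose leading
monomial is divisible by that of some `f j`. -/
lemma mem_span_iff {J : Set ι} {p : MvPolynomial σ K} :
    p ∈ Ideal.span (f '' J) ↔ ∀ s ∈ (h.basis.repr p).support, ∃ j ∈ J, e j ≤ s := by
  have hiff := h.basis.mem_span_image (m := p) (s := {s | ∃ j ∈ J, e j ≤ s})
  refine Iff.trans ⟨fun hp => ?_, fun hp => ?_⟩ hiff
  · have key : ∀ a : MvPolynomial σ K,
        a * p ∈ Submodule.span K (h.basis '' {s | ∃ j ∈ J, e j ≤ s}) := by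
      refine Submodule.span_induction ?_ ?_ ?_ ?_ hp
      · rintro _ ⟨j, hj, rfl⟩ a
        refine Submodule.span_induction (p := fun a _ => a * f j ∈ _) ?_ ?_ ?_ ?_
          (h.basis.mem_span a)
        · rintro _ ⟨s, rfl⟩
          rw [basis_apply, mul_comm, h.mul_mixedMonomial, ← h.basis_apply]
          exact Submodule.subset_span ⟨_, ⟨j, hj, le_add_self⟩, rfl⟩
        · simp
        · intro x y _ _ hx hy
          rw [add_mul]; exact add_mem hx hy
        · intro c x _ hx
          rw [smul_mul_assoc]; exact Submodule.smul_mem _ _ hx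
      · simp
      · intro x y _ _ hx hy a
        rw [mul_add]; exact add_mem (hx a) (hy a)
      · intro b x _ hx a
        rw [smul_eq_mul, ← mul_assoc]; exact hx _
    simpa using key 1
  · refine (Submodule.span_le (p := (Ideal.span (f '' J)).restrictScalars K)).2 ?_ hp
    rintro _ ⟨s, ⟨j, hj, hjs⟩, rfl⟩
    rw [basis_apply, ← tsub_add_cancel_of_le hjs, ← h.mul_mixedMonomial]
    exact Ideal.mul_mem_right _ _ (Ideal.subset_span ⟨j, hj, rfl⟩)

/-- An element which shifts the basis by `u` is a nonzerodivisor modulo the `f j` whose leading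
monomial is coprime to `x ^ u`. -/
lemma mem_span_of_mul_mem {J : Set ι} {u : σ →₀ ℕ} {a p : MvPolynomial σ K}
    (ha : ∀ s, a * mixedMonomial e f s = mixedMonomial e f (s + u))
    (hu : ∀ j ∈ J, Disjoint (e j).support u.support) (hp : a * p ∈ Ideal.span (f '' J)) :
    p ∈ Ideal.span (f '' J) := by
  have hrepr : h.basis.repr (a * p) = (h.basis.repr p).mapDomain (· + u) := by
    have : h.basis.repr.toLinearMap ∘ₗ LinearMap.mulLeft K a =
        Finsupp.lmapDomain K K (· + u) ∘ₗ h.basis.repr.toLinearMap := by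
      refine h.basis.ext fun s => ?_
      simp only [LinearMap.comp_apply, LinearMap.mulLeft_apply, LinearEquiv.coe_coe,
        Module.Basis.repr_self, Finsupp.lmapDomain_apply, Finsupp.mapDomain_single]
      rw [basis_apply, ha, ← h.basis_apply, Module.Basis.repr_self]
    exact LinearMap.congr_fun this p
  rw [h.mem_span_iff] at hp ⊢
  intro s hs
  have hs' : s + u ∈ (h.basis.repr (a * p)).support := by
    rw [hrepr, Finsupp.mem_support_iff, Finsupp.mapDomain_apply (add_left_injective u)]
    exact Finsupp.mem_support_iff.1 hs
  obtain ⟨j, hj, hle⟩ := hp _ hs'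
  refine ⟨j, hj, ?_⟩
  have := (nsmul_le_add_iff_of_disjoint (hu j hj) s 1).1 (by simpa using hle)
  simpa using this

/-- The polynomials `f j` form a regular sequence in any order. -/
lemma mem_span_of_mul_mem_of_notMem {J : Set ι} {l : ι} (hl : l ∉ J) {p : MvPolynomial σ K}
    (hp : f l * p ∈ Ideal.span (f '' J)) : p ∈ Ideal.span (f '' J) :=
  h.mem_span_of_mul_mem (h.mul_mixedMonomial l)
    (fun _ hj => h.disjoint (ne_of_mem_of_not_mem hj hl)) hp

lemma mem_span_of_X_mul_mem {J : Set ι} {i : σ} (hi : ∀ j, i ∉ (e j).support)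
    {p : MvPolynomial σ K} (hp : X i * p ∈ Ideal.span (f '' J)) : p ∈ Ideal.span (f '' J) := by
  have hdis : ∀ j, Disjoint (e j).support (Finsupp.single i 1 : σ →₀ ℕ).support := fun j =>
    Finset.disjoint_right.2 fun k hk => by
      obtain rfl : k = i := by simpa using Finsupp.support_single_subset hk
      exact hi j
  exact h.mem_span_of_mul_mem (h.monomial_mul_mixedMonomial hdis) (fun j _ => hdis j) hp

end CoprimeLeads

end Lead

/-! ### Height of the ideal -/

section Height

variable {σ ι K : Type*} [Field K] [Fintype ι] {w : σ → ℕ} {e : ι → σ →₀ ℕ}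
  {f : ι → MvPolynomial σ K}

namespace CoprimeLeads

variable (h : CoprimeLeads w e f)

include h

lemma span_ne_top (J : Set ι) : Ideal.span (f '' J) ≠ ⊤ := by
  classical
  rw [Ideal.ne_top_iff_one]
  intro h1
  -- no monomial has weight smaller than that of `1`
  have hb : h.basis 0 = 1 := by
    have h0 := h.hasLead_mixedMonomial 0
    simp only [HasLead, map_zero, not_lt_zero, Set.ofPred_false] at h0
    rw [mem_restrictSupport_iff, Set.subset_empty_iff, Finset.coe_eq_empty, support_eq_empty,
      sub_eq_zero] at h0
    rw [basis_apply, h0]; rfl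
  rw [h.mem_span_iff, ← hb, Module.Basis.repr_self] at h1
  obtain ⟨j, -, hj⟩ := h1 0 (by simp)
  exact h.ne_zero j (le_antisymm hj (zero_le))

/-- The lower bound for the height, by induction along the regular sequence of the `f j`. -/
lemma card_le_height_of_isPrime (J : Finset ι) (P : Ideal (MvPolynomial σ K)) [P.IsPrime]
    (hP : Ideal.span (f '' J) ≤ P) : (J.card : ℕ∞) ≤ P.height := by
  classical
  induction J using Finset.induction_on generalizing P with
  | empty => simp
  | insert l J hl ih =>
    have hle : Ideal.span (f '' J) ≤ P :=
      (Ideal.span_mono (Set.image_mono (by simp))).trans hP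
    -- a minimal prime over the ideal of `J` consists of zero divisors, so it does not contain `f l`
    obtain ⟨Q, hQ, hQP⟩ := Ideal.exists_minimalPrimes_le hle
    have := hQ.isPrime
    have hlt : Q < P := by
      refine lt_of_le_of_ne hQP ?_
      rintro rfl
      have hlQ : f l ∈ Q := hP (Ideal.subset_span ⟨l, by simp, rfl⟩)
      obtain ⟨y, hy, hxy⟩ := Ideal.exists_mul_mem_of_mem_minimalPrimes hQ hlQ
      exact hy (h.mem_span_of_mul_mem_of_notMem (by simpa using hl) hxy)
    rw [Finset.card_insert_of_notMem hl, Nat.cast_succ]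
    exact (add_le_add_left (ih Q hQ.le) 1).trans
      (Ideal.height_add_one_le_of_lt_of_isPrime hlt)

lemma height_span [Finite σ] (J : Finset ι) : (Ideal.span (f '' J)).height = J.card := by
  classical
  apply le_antisymm
  · obtain ⟨P, hP⟩ := Ideal.nonempty_minimalPrimes (h.span_ne_top (J : Set ι))
    rw [Ideal.height_eq_inf_minimalPrimes]
    refine (iInf₂_le P hP).trans ?_
    rw [← Finset.coe_image] at hP
    exact (Ideal.height_le_card_of_mem_minimalPrimes_span_finset hP).trans
      (by exact_mod_cast Finset.card_image_le)
  · rw [Ideal.height_eq_inf_minimalPrimes]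
    refine le_iInf₂ fun P hP => ?_
    have := hP.isPrime
    exact h.card_le_height_of_isPrime J P hP.le

end CoprimeLeads

end Height

/-! ### Hilbert functions -/

section Hilbert

variable {σ ι : Type*}

/-- The exponents of the monomials of degree `k` which are divisible by no `x ^ e j` with
`j ∈ J`. -/
def standardExponents (e : ι → σ →₀ ℕ) (J : Set ι) (k : ℕ) : Set (σ →₀ ℕ) :=
  {s | s.degree = k ∧ ∀ j ∈ J, ¬ e j ≤ s}

lemma finite_standardExponents [Finite σ] (e : ι → σ →₀ ℕ) (J : Set ι) (k : ℕ) :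
    (standardExponents e J k).Finite :=
  (Finsupp.finite_of_degree_eq k).subset fun _ hs => hs.1

/-- Among the monomials divisible by no `x ^ e j` with `j ∈ J`, the multiples of `x ^ e l` are
counted by a shift of degrees. -/
lemma ncard_standardExponents_insert [Finite σ] {e : ι → σ →₀ ℕ}
    (hd : Pairwise fun j l => Disjoint (e j).support (e l).support) {J : Set ι} {l : ι}
    (hl : l ∉ J) (k : ℕ) :
    (standardExponents e (insert l J) (k + (e l).degree)).ncard +
      (standardExponents e J k).ncard = (standardExponents e J (k + (e l).degree)).ncard := by
  have hunion : standardExponents e J (k + (e l).degree) =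
      standardExponents e (insert l J) (k + (e l).degree) ∪
        (· + e l) '' standardExponents e J k := by
    have hiff : ∀ j ∈ J, ∀ s : σ →₀ ℕ, e j ≤ s + e l ↔ e j ≤ s := fun j hj s => by
      simpa using nsmul_le_add_iff_of_disjoint (hd (ne_of_mem_of_not_mem hj hl)) s 1
    ext s
    constructor
    · rintro ⟨hs, hJ⟩
      by_cases hls : e l ≤ s
      · obtain ⟨u, rfl⟩ := exists_add_of_le hls
        rw [add_comm (e l)] at hs hJ ⊢
        refine Or.inr ⟨u, ⟨?_, fun j hj => ?_⟩, rfl⟩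
        · rw [map_add] at hs; exact Nat.add_right_cancel hs
        · rw [← hiff j hj]; exact hJ j hj
      · refine Or.inl ⟨hs, ?_⟩
        rintro j (rfl | hj)
        · exact hls
        · exact hJ j hj
    · rintro (⟨hs, hJ⟩ | ⟨u, ⟨hu, hJ⟩, rfl⟩)
      · exact ⟨hs, fun j hj => hJ j (Or.inr hj)⟩
      · refine ⟨by simp [hu], fun j hj => ?_⟩
        rw [hiff j hj]; exact hJ j hj
  rw [hunion, Set.ncard_union_eq ?_ (finite_standardExponents _ _ _)
    ((finite_standardExponents _ _ _).image _), Set.ncard_image_of_injective _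
    (add_left_injective (e l))]
  rw [Set.disjoint_right]
  rintro _ ⟨u, -, rfl⟩ ⟨-, hJ⟩
  exact hJ l (Or.inl rfl) le_add_self

lemma ncard_standardExponents_empty [Fintype σ] (e : ι → σ →₀ ℕ) {N : ℕ}
    (hN : Fintype.card σ = N + 1) (k : ℕ) :
    (standardExponents e ∅ k).ncard = (k + N).choose N := by
  classical
  have : standardExponents e ∅ k = ((Finset.univ : Finset σ).finsuppAntidiag k : Set (σ →₀ ℕ)) := by
    ext s
    simp [standardExponents, Finsupp.degree_eq_sum]
  rw [this, Set.ncard_coe_finset, Finset.card_finsuppAntidiag_nat_eq_choose, Finset.card_univ, hN,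
    add_right_comm, Nat.add_sub_cancel, add_comm, Nat.choose_symm_add]

/-- The function `H` eventually agrees with a polynomial of degree `N` and leading coefficient
`δ / N!`. -/
def HasGrowth (H : ℕ → ℕ) (N δ : ℕ) : Prop :=
  ∃ P : Polynomial ℚ, P ≠ 0 ∧ P.natDegree = N ∧ P.leadingCoeff * (N.factorial : ℚ) = δ ∧
    ∀ᶠ k : ℕ in atTop, (H k : ℚ) = P.eval (k : ℚ)

/-- The difference of a polynomial of positive degree and a translate of it. -/
lemma natDegree_and_coeff_sub_taylor {P : Polynomial ℚ} {N : ℕ} (hP : P.natDegree = N + 1)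
    {d : ℕ} (hd : d ≠ 0) :
    (P - Polynomial.taylor (-d : ℚ) P).natDegree = N ∧
      (P - Polynomial.taylor (-d : ℚ) P).leadingCoeff = (N + 1) * d * P.leadingCoeff := by
  have hP0 : P ≠ 0 := by rintro rfl; simp at hP
  have hcoeff : (P - Polynomial.taylor (-d : ℚ) P).coeff N = (N + 1) * d * P.leadingCoeff := by
    -- only two terms of the Taylor expansion contribute to the coefficient of degree `N`
    rw [Polynomial.coeff_sub, Polynomial.taylor_coeff, Polynomial.hasseDeriv_apply,
      Polynomial.sum_over_range' _ (by simp) (N + 2) (by lia), Finset.sum_range_succ,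
      Finset.sum_range_succ, Finset.sum_eq_zero, Polynomial.leadingCoeff, hP]
    · simp [Nat.choose_succ_self_right]
      ring
    · intro x hx
      rw [Nat.choose_eq_zero_of_lt (Finset.mem_range.1 hx)]
      simp
  have hle : (P - Polynomial.taylor (-d : ℚ) P).natDegree ≤ N := by
    rw [Polynomial.natDegree_le_iff_coeff_eq_zero]
    intro M hM
    rcases eq_or_lt_of_le (Nat.succ_le_of_lt hM) with h | h
    · have := Polynomial.coeff_taylor_natDegree (r := (-d : ℚ)) (f := P)
      rw [hP, Polynomial.leadingCoeff, hP] at this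
      rw [← h, Polynomial.coeff_sub, Nat.succ_eq_add_one, this, sub_self]
    · rw [Polynomial.coeff_sub, Polynomial.coeff_eq_zero_of_natDegree_lt (by lia),
        Polynomial.coeff_eq_zero_of_natDegree_lt
          (by rw [Polynomial.natDegree_taylor]; lia), sub_self]
  have hne : (P - Polynomial.taylor (-d : ℚ) P).coeff N ≠ 0 := by
    rw [hcoeff]
    have : P.leadingCoeff ≠ 0 := by simpa using hP0
    positivity
  have heq := le_antisymm hle (Polynomial.le_natDegree_of_ne_zero hne)
  exact ⟨heq, by rw [Polynomial.leadingCoeff, heq, hcoeff]⟩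

/-- If `H' k = H k - H (k - d)`, the degree of growth drops by one and the leading coefficient is
multiplied by `d`, up to the change of factorials. -/
lemma HasGrowth.of_shift {H H' : ℕ → ℕ} {N δ d : ℕ} (hH : HasGrowth H (N + 1) δ)
    (hd : d ≠ 0) (hs : ∀ k, H' (k + d) + H k = H (k + d)) : HasGrowth H' N (d * δ) := by
  obtain ⟨P, hP0, hdeg, hlc, hev⟩ := hH
  obtain ⟨h1, h2⟩ := natDegree_and_coeff_sub_taylor hdeg hd
  have hlc0 : P.leadingCoeff ≠ 0 := by simpa using hP0
  refine ⟨P - Polynomial.taylor (-d : ℚ) P, ?_, h1, ?_, ?_⟩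
  · rw [← Polynomial.leadingCoeff_ne_zero, h2]
    positivity
  · rw [h2, Nat.cast_mul, ← hlc, Nat.factorial_succ]
    push_cast; ring
  · rw [eventually_atTop] at hev ⊢
    obtain ⟨M, hM⟩ := hev
    refine ⟨M + d, fun k hk => ?_⟩
    obtain ⟨k, rfl⟩ : ∃ j, k = j + d := ⟨k - d, by lia⟩
    have e1 := hM k (by lia)
    have e2 := hM (k + d) (by lia)
    have e3 : (H' (k + d) : ℚ) + H k = H (k + d) := by exact_mod_cast hs k
    rw [Polynomial.eval_sub, Polynomial.taylor_eval, ← e2]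
    push_cast
    rw [add_neg_cancel_right, ← e1]
    linarith

lemma hasGrowth_standardExponents [Fintype σ] {e : ι → σ →₀ ℕ}
    (hd : Pairwise fun j l => Disjoint (e j).support (e l).support) {d : ℕ} (hd0 : d ≠ 0)
    (hdeg : ∀ j, (e j).degree = d) (J : Finset ι) {N : ℕ}
    (hN : Fintype.card σ = N + 1 + J.card) :
    HasGrowth (fun k => (standardExponents e J k).ncard) N (d ^ J.card) := by
  classical
  induction J using Finset.induction_on generalizing N with
  | empty =>
    refine ⟨Polynomial.preHilbertPoly ℚ N 0, ?_, Polynomial.natDegree_preHilbertPoly ℚ N 0, ?_,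
      Eventually.of_forall fun k => ?_⟩
    · rw [← Polynomial.leadingCoeff_ne_zero, Polynomial.leadingCoeff_preHilbertPoly]
      positivity
    · rw [Polynomial.leadingCoeff_preHilbertPoly, inv_mul_cancel₀ (by positivity)]
      simp
    · rw [Polynomial.preHilbertPoly_eq_choose_sub_add ℚ N (Nat.zero_le k)]
      simp [ncard_standardExponents_empty e (by simpa using hN)]
  | insert l J hl ih =>
    rw [Finset.card_insert_of_notMem hl] at hN ⊢
    rw [pow_succ']
    refine (ih (N := N + 1) (by lia)).of_shift hd0 fun k => ?_
    have := ncard_standardExponents_insert hd (J := (J : Set ι)) (l := l) (by simpa using hl) k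
    rw [hdeg] at this
    simpa using this

namespace CoprimeLeads

variable [Fintype ι] {w : σ → ℕ} {e : ι → σ →₀ ℕ} {f : ι → MvPolynomial σ ℂ}
  (h : CoprimeLeads w e f)

include h

lemma isHomogeneous_mixedMonomial (hf : ∀ j, (f j).IsHomogeneous (e j).degree) (s : σ →₀ ℕ) :
    (mixedMonomial e f s).IsHomogeneous s.degree := by
  have hle := sum_expMultiplicity_le h.ne_zero h.disjoint s
  have h1 : (∏ j, f j ^ expMultiplicity (e j) s).IsHomogeneous
      (∑ j, expMultiplicity (e j) s • e j).degree := by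
    rw [map_sum]
    refine IsHomogeneous.prod _ _ _ fun j _ => ?_
    rw [map_nsmul, smul_eq_mul, mul_comm]
    exact (hf j).pow _
  have h2 := h1.mul (isHomogeneous_monomial (1 : ℂ)
    (rfl : (s - ∑ j, expMultiplicity (e j) s • e j).degree = _))
  rwa [← map_add, add_tsub_cancel_of_le hle] at h2

/-- As the basis consists of forms, those of degree `k` span the forms of degree `k`. -/
lemma homogeneousSubmodule_eq_span (hf : ∀ j, (f j).IsHomogeneous (e j).degree) (k : ℕ) :
    homogeneousSubmodule σ ℂ k = Submodule.span ℂ (h.basis '' {s | s.degree = k}) := by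
  apply le_antisymm
  · intro p hp
    rw [← homogeneousComponent_of_mem (m := k) hp |>.trans (if_pos rfl)]
    refine Submodule.span_induction ?_ ?_ ?_ ?_ (h.basis.mem_span p)
    · rintro _ ⟨s, rfl⟩
      have hs : h.basis s ∈ homogeneousSubmodule σ ℂ s.degree := by
        rw [basis_apply]; exact h.isHomogeneous_mixedMonomial hf s
      rw [homogeneousComponent_of_mem hs]
      split_ifs with hk
      · exact Submodule.subset_span ⟨s, hk.symm, rfl⟩
      · exact zero_mem _
    · simp
    · intro x y _ _ hx hy
      rw [map_add]; exact add_mem hx hy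
    · intro c x _ hx
      rw [map_smul]; exact Submodule.smul_mem _ _ hx
  · rw [Submodule.span_le]
    rintro _ ⟨s, rfl, rfl⟩
    rw [basis_apply]
    exact h.isHomogeneous_mixedMonomial hf s

/-- The Hilbert function is that of the monomial ideal generated by the leading monomials. -/
lemma hilbertFunction_span [Finite σ] (hf : ∀ j, (f j).IsHomogeneous (e j).degree) (J : Set ι)
    (k : ℕ) :
    hilbertFunction (Ideal.span (f '' J)) k = (standardExponents e J k).ncard := by
  classical
  set I := Ideal.span (f '' J)
  set π := (Ideal.Quotient.mkₐ ℂ I).toLinearMap with hπ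
  have hker : ∀ p, π p = 0 ↔ p ∈ I := fun p => Ideal.Quotient.eq_zero_iff_mem
  have hspan : (homogeneousSubmodule σ ℂ k).map π =
      Submodule.span ℂ (Set.range fun s : standardExponents e J k => π (h.basis s)) := by
    rw [h.homogeneousSubmodule_eq_span hf, Submodule.map_span]
    apply le_antisymm
    · rw [Submodule.span_le]
      rintro _ ⟨_, ⟨s, hs, rfl⟩, rfl⟩
      by_cases hJ : ∀ j ∈ J, ¬ e j ≤ s
      · exact Submodule.subset_span ⟨⟨s, hs, hJ⟩, rfl⟩
      · push Not at hJ
        have : π (h.basis s) = 0 := by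
          rw [hker, h.mem_span_iff, Module.Basis.repr_self]
          intro u hu
          obtain rfl : u = s := by simpa using Finsupp.support_single_subset hu
          exact hJ
        rw [this]; exact zero_mem _
    · refine Submodule.span_mono ?_
      rintro _ ⟨s, rfl⟩
      exact ⟨_, ⟨s, s.2.1, rfl⟩, rfl⟩
  have hli : LinearIndependent ℂ fun s : standardExponents e J k => π (h.basis s) := by
    refine (h.basis.linearIndependent.comp _ Subtype.val_injective).map (f := π) ?_
    rw [Submodule.disjoint_def]
    intro x hx hx'
    rw [Set.range_comp, Subtype.range_coe, Module.Basis.mem_span_image] at hx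
    rw [LinearMap.mem_ker, hker, h.mem_span_iff] at hx'
    rw [← h.basis.repr.map_eq_zero_iff, ← Finsupp.support_eq_empty, Finset.eq_empty_iff_forall_notMem]
    intro s hs
    obtain ⟨j, hj, hle⟩ := hx' s hs
    exact (hx hs).2 j hj hle
  have := (finite_standardExponents e J k).fintype
  rw [hilbertFunction, hspan, finrank_span_eq_card hli, ← Nat.card_eq_fintype_card,
    Nat.card_coe_set_eq]

lemma hasDegree_span [Fintype σ] {d : ℕ} (hd0 : d ≠ 0) (hdeg : ∀ j, (e j).degree = d)
    (hf : ∀ j, (f j).IsHomogeneous d) (hσ : Fintype.card ι + 1 ≤ Fintype.card σ) :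
    HasDegree (Ideal.span (Set.range f)) (d ^ Fintype.card ι) := by
  obtain ⟨P, hP0, h1, h2, h3⟩ := hasGrowth_standardExponents h.disjoint hd0 hdeg Finset.univ
    (N := Fintype.card σ - 1 - Fintype.card ι) (by rw [Finset.card_univ]; lia)
  refine ⟨P, hP0, ?_, by rw [h1, h2, Finset.card_univ]⟩
  filter_upwards [h3] with k hk
  rw [← hk, ← Set.image_univ, ← Finset.coe_univ,
    h.hilbertFunction_span (fun j => by rw [hdeg]; exact hf j)]

end CoprimeLeads

end Hilbert

/-! ### The Fermat form is prime in at least three variables -/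

section Fermat

/-- A sum of at least two powers of independent variables has no multiple factor: such a factor
would divide all the partial derivatives, so two different variables. -/
lemma not_sq_dvd_sum_X_pow {k d : ℕ} (hk : 2 ≤ k) (hd : d ≠ 0)
    {p : MvPolynomial (Fin k) ℂ} (hp : Prime p) : ¬ p * p ∣ ∑ i : Fin k, X i ^ d := by
  rintro ⟨q, hq⟩
  have hdvd : ∀ i : Fin k, p ∣ X i := by
    intro i
    have h1 : pderiv i (∑ j : Fin k, (X j : MvPolynomial (Fin k) ℂ) ^ d) =
        C (d : ℂ) * X i ^ (d - 1) := by
      rw [map_sum, Finset.sum_eq_single i]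
      · rw [Derivation.leibniz_pow, pderiv_X_self]
        simp
      · intro j _ hj
        rw [Derivation.leibniz_pow, pderiv_X_of_ne hj]
        simp
      · simp
    have h2 : p ∣ C (d : ℂ) * X i ^ (d - 1) := by
      rw [← h1, hq, Derivation.leibniz, Derivation.leibniz]
      simp only [smul_eq_mul]
      exact dvd_add ⟨p * pderiv i q, by ring⟩ ⟨q * (pderiv i p + pderiv i p), by ring⟩
    have hu : IsUnit (C (d : ℂ) : MvPolynomial (Fin k) ℂ) :=
      (isUnit_iff_ne_zero.2 (by exact_mod_cast hd)).map C
    exact hp.dvd_of_dvd_pow (hu.dvd_mul_left.1 h2)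
  have hass : Associated p (X (⟨0, by lia⟩ : Fin k)) :=
    hp.irreducible.associated_of_dvd X_prime.irreducible (hdvd _)
  have h01 : (X (⟨0, by lia⟩ : Fin k) : MvPolynomial (Fin k) ℂ) ∣ X ⟨1, by lia⟩ :=
    hass.symm.dvd.trans (hdvd _)
  have := map_dvd (eval fun i : Fin k => if i.1 = 1 then (1 : ℂ) else 0) h01
  simp at this

/-- The proof is Eisenstein's criterion, for the first variable and a prime factor of the sum of
the powers of the others. -/
lemma prime_sum_X_pow {m d : ℕ} (hm : 3 ≤ m) (hd : 2 ≤ d) :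
    Prime (∑ i : Fin m, (X i : MvPolynomial (Fin m) ℂ) ^ d) := by
  obtain ⟨k, rfl⟩ : ∃ k, m = k + 1 := ⟨m - 1, by lia⟩
  rw [← irreducible_iff_prime, ← MulEquiv.irreducible_iff (finSuccEquiv ℂ k)]
  set c : MvPolynomial (Fin k) ℂ := ∑ i : Fin k, X i ^ d with hc
  have hF : finSuccEquiv ℂ k (∑ i : Fin (k + 1), X i ^ d) = Polynomial.X ^ d + Polynomial.C c := by
    rw [Fin.sum_univ_succ, map_add, map_pow, finSuccEquiv_X_zero, map_sum, hc, map_sum]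
    simp only [map_pow, finSuccEquiv_X_succ]
  have hc0 : c ≠ 0 := by
    intro h0
    have := congrArg (eval fun i : Fin k => if i.1 = 0 then (1 : ℂ) else 0) h0
    rw [hc, map_sum, Finset.sum_eq_single (⟨0, by lia⟩ : Fin k)] at this
    · simp at this
    · intro j _ hj
      have : j.1 ≠ 0 := fun h => hj (Fin.ext h)
      simp [this, show d ≠ 0 by lia]
    · simp
  have hcu : ¬ IsUnit c := by
    intro hu
    have := hu.map (eval fun _ : Fin k => (0 : ℂ))
    simp [hc, show d ≠ 0 by lia] at this
  obtain ⟨p, hp, hpc⟩ := WfDvdMonoid.exists_irreducible_factor hcu hc0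
  have hp' := hp.prime
  have hdeg : (Polynomial.X ^ d + Polynomial.C c).degree = (d : WithBot ℕ) :=
    Polynomial.degree_X_pow_add_C (by lia) c
  have hmonic : (Polynomial.X ^ d + Polynomial.C c).Monic :=
    Polynomial.monic_X_pow_add_C c (show d ≠ 0 by lia)
  rw [hF]
  refine Polynomial.irreducible_of_eisenstein_criterion
    (P := Ideal.span {p}) ((Ideal.span_singleton_prime hp'.ne_zero).2 hp') ?_ ?_ ?_ ?_
    hmonic.isPrimitive
  · rw [hmonic.leadingCoeff, Ideal.mem_span_singleton]
    exact fun h => hp.not_isUnit (isUnit_of_dvd_one h)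
  · intro n hn
    rw [hdeg, Nat.cast_lt] at hn
    rw [Polynomial.coeff_add, Polynomial.coeff_X_pow, if_neg hn.ne, zero_add, Polynomial.coeff_C]
    split_ifs
    · exact Ideal.mem_span_singleton.2 hpc
    · exact zero_mem _
  · rw [hdeg]; exact_mod_cast (by lia : 0 < d)
  · rw [Polynomial.coeff_add, Polynomial.coeff_X_pow, if_neg (by lia), zero_add,
      Polynomial.coeff_C_zero, Ideal.span_singleton_pow, Ideal.mem_span_singleton, sq]
    exact not_sq_dvd_sum_X_pow (by lia) (by lia) hp'

end Fermat

/-! ### Primality by elimination of the last row -/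

section Elimination

variable {n d r : ℕ}

/-- The polynomials in the `α_{i,0}`, as polynomials in all the coordinates. -/
noncomputable def firstColumn (n r : ℕ) :
    MvPolynomial (Fin (r - 1)) ℂ →+* MvPolynomial (Idx n r) ℂ :=
  (rename fun i => ((i, 0) : Idx n r)).toRingHom

@[simp]
lemma firstColumn_X (i : Fin (r - 1)) : firstColumn n r (X i) = X (i, 0) := by
  simp [firstColumn]

@[simp]
lemma firstColumn_C (a : ℂ) : firstColumn n r (C a) = C a := by
  simp [firstColumn]

/-- The polynomials which involve none of the `α_{l,j}` with `j ≥ 1`, written with coefficients in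
the ring of polynomials in the `α_{i,0}`, as polynomials in all the coordinates. -/
noncomputable def omitRow (n r : ℕ) (l : Fin (r - 1)) :
    MvPolynomial ({i // i ≠ l} × Fin n) (MvPolynomial (Fin (r - 1)) ℂ) →+*
      MvPolynomial (Idx n r) ℂ :=
  eval₂Hom (firstColumn n r) fun p => X (p.1.1, p.2.succ)

@[simp]
lemma omitRow_C (l : Fin (r - 1)) (a : MvPolynomial (Fin (r - 1)) ℂ) :
    omitRow n r l (C a) = firstColumn n r a := by
  simp [omitRow]

@[simp]
lemma omitRow_X (l : Fin (r - 1)) (p : {i // i ≠ l} × Fin n) :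
    omitRow n r l (X p) = X (p.1.1, p.2.succ) := by
  simp [omitRow]

open Classical in
/-- For a homomorphism `τ` to a field from the ring of polynomials in the `α_{i,0}`, the extension
to all coordinates which solves the equations `g_j = 0` for `α_{l,j}` and leaves the other
`α_{i,j}` with `j ≥ 1` free. It has this meaning when `τ` is nonzero at `α_{l,0}`. -/
noncomputable def solveRow {L : Type*} [Field L] (n d : ℕ) (l : Fin (r - 1))
    (τ : MvPolynomial (Fin (r - 1)) ℂ →+* L) :
    MvPolynomial (Idx n r) ℂ →+* MvPolynomial ({i // i ≠ l} × Fin n) L :=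
  eval₂Hom ((C.comp τ).comp C) fun p => Fin.cases (C (τ (X p.1)))
    (fun j => if h : p.1 ≠ l then X (⟨p.1, h⟩, j) else
      -(C ((τ (X l))⁻¹ ^ (d - 1)) *
        ∑ i : {i // i ≠ l}, C (τ (X i.1) ^ (d - 1)) * X (i, j))) p.2

section SolveRow

variable {L : Type*} [Field L] (l : Fin (r - 1)) (τ : MvPolynomial (Fin (r - 1)) ℂ →+* L)

lemma solveRow_firstColumn (a : MvPolynomial (Fin (r - 1)) ℂ) :
    solveRow n d l τ (firstColumn n r a) = C (τ a) := by
  have : (solveRow n d l τ).comp (firstColumn n r) = C.comp τ := by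
    refine ringHom_ext (fun a => ?_) fun i => ?_
    · simp [solveRow]
    · simp [solveRow]
  exact RingHom.congr_fun this a

lemma solveRow_omitRow (q : MvPolynomial ({i // i ≠ l} × Fin n) (MvPolynomial (Fin (r - 1)) ℂ)) :
    solveRow n d l τ (omitRow n r l q) = MvPolynomial.map τ q := by
  have : (solveRow n d l τ).comp (omitRow n r l) = MvPolynomial.map τ := by
    refine ringHom_ext (fun a => ?_) fun p => ?_
    · simp [solveRow_firstColumn]
    · have := p.1.2
      simp [solveRow, this]
  exact RingHom.congr_fun this q

lemma solveRow_g (hl : τ (X l) ≠ 0) (j : Fin n) : solveRow n d l τ (g n d r j) = 0 := by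
  classical
  have h0 : ∀ i, solveRow n d l τ (X (i, 0)) = C (τ (X i)) := fun i => by simp [solveRow]
  have h1 : ∀ i : {i // i ≠ l}, solveRow n d l τ (X (i.1, j.succ)) = X (i, j) := fun i => by
    have := i.2
    simp [solveRow, this]
  have h2 : solveRow n d l τ (X (l, j.succ)) = -(C ((τ (X l))⁻¹ ^ (d - 1)) *
      ∑ i : {i // i ≠ l}, C (τ (X i.1) ^ (d - 1)) * X (i, j)) := by
    simp [solveRow]
  rw [g, map_sum, Fintype.sum_eq_add_sum_subtype_ne _ l]
  simp only [map_mul, map_pow, h0, h1, h2]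
  have h3 : (C (τ (X l)) * C ((τ (X l))⁻¹) : MvPolynomial ({i // i ≠ l} × Fin n) L) = 1 := by
    rw [← C_mul, mul_inv_cancel₀ hl, C_1]
  rw [mul_neg, ← mul_assoc, ← mul_pow, h3, one_pow, one_mul, neg_add_cancel]

end SolveRow

/-- Modulo the `g_j`, a power of `α_{l,0}` clears the `α_{l,j}` with `j ≥ 1` from a polynomial. -/
lemma exists_pow_mul_sub_omitRow_mem {I : Ideal (MvPolynomial (Idx n r) ℂ)}
    (hI : eigenIdeal n d r ≤ I) (l : Fin (r - 1)) (p : MvPolynomial (Idx n r) ℂ) :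
    ∃ N q, X (l, 0) ^ N * p - omitRow n r l q ∈ I := by
  classical
  simp only [← Ideal.Quotient.eq, map_mul, map_pow]
  set π := Ideal.Quotient.mk I
  have hπl : π (omitRow n r l (C (X l))) = π (X (l, 0)) := by simp
  have mulStep : ∀ p p', (∃ N q, π (X (l, 0)) ^ N * π p = π (omitRow n r l q)) →
      (∃ N q, π (X (l, 0)) ^ N * π p' = π (omitRow n r l q)) →
      ∃ N q, π (X (l, 0)) ^ N * π (p * p') = π (omitRow n r l q) := by
    rintro p p' ⟨N, q, h⟩ ⟨N', q', h'⟩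
    refine ⟨N + N', q * q', ?_⟩
    rw [map_mul, map_mul, map_mul, ← h, ← h']
    ring
  induction p using MvPolynomial.induction_on with
  | C a => exact ⟨0, C (C a), by simp⟩
  | add p p' h h' =>
    obtain ⟨N, q, h⟩ := h
    obtain ⟨N', q', h'⟩ := h'
    refine ⟨N + N', C (X l) ^ N' * q + C (X l) ^ N * q', ?_⟩
    simp only [map_add, map_mul, map_pow, hπl, ← h, ← h']
    ring
  | mul_X p i h =>
    refine mulStep _ _ h ?_
    obtain ⟨i, j⟩ := i
    induction j using Fin.cases with
    | zero => exact ⟨0, C (X i), by simp⟩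
    | succ j =>
      by_cases hi : i = l
      · subst hi
        refine ⟨d - 1, -∑ k : {k // k ≠ i}, C (X k.1 ^ (d - 1)) * X (k, j), ?_⟩
        have hg : π (g n d r j) = 0 :=
          Ideal.Quotient.eq_zero_iff_mem.2 (hI (Ideal.subset_span ⟨j, rfl⟩))
        rw [g, map_sum, Fintype.sum_eq_add_sum_subtype_ne _ i, add_eq_zero_iff_eq_neg] at hg
        rw [← map_pow, ← map_mul, hg]
        simp
      · exact ⟨0, X (⟨i, hi⟩, j), by simp⟩

/-- Let `I` be generated by the `g_j` and a prime ideal of polynomials in the `α_{i,0}`. If some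
`α_{l,0}` is a nonzerodivisor modulo `I`, then `I` is prime: after inversion of `α_{l,0}` the
equations can be solved for the `α_{l,j}`. -/
lemma isPrime_of_X_mul_mem {I : Ideal (MvPolynomial (Idx n r) ℂ)}
    (J : Ideal (MvPolynomial (Fin (r - 1)) ℂ)) [J.IsPrime]
    (hI : I = J.map (firstColumn n r) ⊔ eigenIdeal n d r) (hne : I ≠ ⊤) (l : Fin (r - 1))
    (hreg : ∀ p, X (l, 0) * p ∈ I → p ∈ I) : I.IsPrime := by
  set L := FractionRing (MvPolynomial (Fin (r - 1)) ℂ ⧸ J)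
  set τ : MvPolynomial (Fin (r - 1)) ℂ →+* L := (algebraMap _ L).comp (Ideal.Quotient.mk J)
  have hτ : ∀ a, τ a = 0 ↔ a ∈ J := fun a => by
    simp only [τ, RingHom.comp_apply, FaithfulSMul.algebraMap_eq_zero_iff,
      Ideal.Quotient.eq_zero_iff_mem]
  have hJI : J.map (firstColumn n r) ≤ I := hI ▸ le_sup_left
  have hgI : eigenIdeal n d r ≤ I := hI ▸ le_sup_right
  have hl : τ (X l) ≠ 0 := by
    rw [Ne, hτ]
    intro h
    refine hne ((Ideal.eq_top_iff_one I).2 (hreg 1 ?_))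
    simpa using hJI (Ideal.mem_map_of_mem (firstColumn n r) h)
  have hle : I ≤ RingHom.ker (solveRow n d l τ) := by
    rw [hI, sup_le_iff, Ideal.map_le_iff_le_comap, eigenIdeal, Ideal.span_le]
    constructor
    · intro a ha
      rw [Ideal.mem_comap, RingHom.mem_ker, solveRow_firstColumn, (hτ a).2 ha, C_0]
    · rintro _ ⟨j, rfl⟩
      exact solveRow_g l τ hl j
  have hpow : ∀ N p, X (l, 0) ^ N * p ∈ I → p ∈ I := by
    intro N
    induction N with
    | zero => simp
    | succ N ih =>
      intro p hp
      rw [pow_succ, mul_assoc] at hp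
      exact hreg p (ih _ hp)
  have hker : RingHom.ker (solveRow n d l τ) = I := by
    refine le_antisymm (fun p hp => ?_) hle
    obtain ⟨N, q, hq⟩ := exists_pow_mul_sub_omitRow_mem hgI l p
    have h0 : MvPolynomial.map τ q = 0 := by
      have := hle hq
      rw [RingHom.mem_ker, map_sub, map_mul, (RingHom.mem_ker.1 hp), mul_zero, zero_sub,
        neg_eq_zero, solveRow_omitRow] at this
      exact this
    have hqJ : q ∈ J.map (C : _ →+* MvPolynomial ({i // i ≠ l} × Fin n) _) := by
      rw [mem_map_C_iff]
      intro u
      rw [← hτ, ← coeff_map, h0, coeff_zero]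
    have hqI : omitRow n r l q ∈ I := by
      have := Ideal.mem_map_of_mem (omitRow n r l) hqJ
      rw [Ideal.map_map, show (omitRow n r l).comp C = firstColumn n r from
        RingHom.ext fun a => omitRow_C l a] at this
      exact hJI this
    exact hpow N p (by simpa using add_mem hq hqI)
  rw [← hker]
  exact RingHom.ker_isPrime _

end Elimination

/-! ### The Bombieri-Weyl product with powers of a linear form -/

section BombieriWeyl

variable {n d r : ℕ}

/-- The multinomial factor is the one which the Bombieri-Weyl product cancels. -/
lemma coeff_linForm_pow (hd : 1 ≤ d) (c : Fin (n + 1) → ℂ) (j : Fin (n + 1)) :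
    coeff (Finsupp.single 0 (d - 1) + Finsupp.single j 1) (linForm c ^ d) =
      (Finsupp.single (0 : Fin (n + 1)) (d - 1) + Finsupp.single j 1).multinomial *
        (c 0 ^ (d - 1) * c j) := by
  have h : linForm c = ∑ i, c i • (X i : MvPolynomial (Fin (n + 1)) ℂ) := by
    simp [linForm, smul_eq_C_mul]
  rw [h, coeff_linearCombination_X_pow_of_fintype, if_pos]
  · rw [Finsupp.prod_add_index' (by simp) (by intros; rw [pow_add]),
      Finsupp.prod_single_index (by simp), Finsupp.prod_single_index (by simp), pow_one]
  · rw [Finsupp.sum_add_index' (by simp) (by simp),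
      Finsupp.sum_single_index rfl, Finsupp.sum_single_index rfl]
    lia

lemma multinomial_ne_zero {σ : Type*} (s : σ →₀ ℕ) : (s.multinomial : ℂ) ≠ 0 := by
  rw [Finsupp.multinomial_eq]
  exact_mod_cast (Nat.multinomial_pos _ _).ne'

/-- Orthogonality to all `x_0^(d-1) M` is the vanishing of the coefficients of the `x_0^(d-1) x_j`. -/
lemma forall_bombieriWeyl_eq_zero_iff (F : MvPolynomial (Fin (n + 1)) ℂ) :
    (∀ M : MvPolynomial (Fin (n + 1)) ℂ, M.IsHomogeneous 1 →
      bombieriWeyl F (X 0 ^ (d - 1) * M) = 0) ↔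
      ∀ j, coeff (Finsupp.single 0 (d - 1) + Finsupp.single j 1) F = 0 := by
  have hX : (X 0 ^ (d - 1) : MvPolynomial (Fin (n + 1)) ℂ) =
      monomial (Finsupp.single 0 (d - 1)) 1 := X_pow_eq_monomial
  constructor
  · intro h j
    have h1 := h (X j) (isHomogeneous_X _ _)
    rw [hX, X, monomial_mul, one_mul, bombieriWeyl,
      Finset.sum_eq_single (Finsupp.single 0 (d - 1) + Finsupp.single j 1)] at h1
    · rw [coeff_monomial, if_pos rfl, mul_one] at h1
      exact (mul_eq_zero.1 h1).resolve_left (inv_ne_zero (multinomial_ne_zero _))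
    · intro s _ hs
      rw [coeff_monomial, if_neg hs.symm, mul_zero, mul_zero]
    · intro hs
      rw [notMem_support_iff.1 hs, zero_mul, mul_zero]
  · intro h M hM
    refine Finset.sum_eq_zero fun s _ => ?_
    rw [hX, coeff_monomial_mul']
    split_ifs with hs
    · by_cases hc : coeff (s - Finsupp.single 0 (d - 1)) M = 0
      · rw [hc, mul_zero, mul_zero, mul_zero]
      · have hdeg : (s - Finsupp.single 0 (d - 1)).degree = 1 := by
          rw [Finsupp.degree_eq_weight_one]; exact hM hc
        obtain ⟨j, hj⟩ : s - Finsupp.single 0 (d - 1) ∈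
            Set.range fun j : Fin (n + 1) => (Finsupp.single j 1 : Fin (n + 1) →₀ ℕ) := by
          rw [Finsupp.range_single_one]; exact hdeg
        have hs' : s = Finsupp.single 0 (d - 1) + Finsupp.single j 1 := by
          rw [← add_tsub_cancel_of_le hs]
          exact congrArg _ hj.symm
        rw [hs', h j]; simp
    · simp

lemma isEigenvectorWith_powerSum_iff (hd : 1 ≤ d) (α : Idx n r → ℂ) (μ : ℂ) :
    IsEigenvectorWith d (powerSum n d r α) (X 0) μ ↔
      1 + eval α (gZero n d r) = μ ∧ ∀ j, eval α (g n d r j) = 0 := by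
  have hX : (X 0 : MvPolynomial (Fin (n + 1)) ℂ) = linForm (Pi.single 0 1) := by
    rw [linForm, Finset.sum_eq_single 0]
    · simp
    · intro j _ hj; simp [hj]
    · simp
  have hcoeff : ∀ j, coeff (Finsupp.single 0 (d - 1) + Finsupp.single j 1)
      (powerSum n d r α - C μ * X 0 ^ d) =
      (Finsupp.single (0 : Fin (n + 1)) (d - 1) + Finsupp.single j 1).multinomial *
        ((1 - μ) * (Pi.single 0 1 : Fin (n + 1) → ℂ) j +
          ∑ i, α (i, 0) ^ (d - 1) * α (i, j)) := by
    intro j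
    rw [powerSum, coeff_sub, coeff_add, coeff_sum, coeff_C_mul, hX]
    simp only [coeff_linForm_pow hd]
    rw [← Finset.mul_sum]
    simp only [Pi.single_eq_same, one_pow]
    ring
  unfold IsEigenvectorWith
  rw [forall_bombieriWeyl_eq_zero_iff]
  simp only [hcoeff, mul_eq_zero, multinomial_ne_zero, false_or]
  rw [Fin.forall_fin_succ]
  refine and_congr ?_ (forall_congr' fun j => ?_)
  · have : eval α (gZero n d r) = ∑ i, α (i, 0) ^ (d - 1) * α (i, 0) := by
      simp [gZero, ← pow_succ, Nat.sub_add_cancel hd]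
    rw [this, Pi.single_eq_same, mul_one, ← sub_eq_zero (b := μ)]
    ring_nf
  · simp [g]

lemma isEigenvector_powerSum_iff (hd : 1 ≤ d) (α : Idx n r → ℂ) :
    IsEigenvector d (powerSum n d r α) (X 0) ↔ ∀ j, eval α (g n d r j) = 0 := by
  simp only [IsEigenvector, isEigenvectorWith_powerSum_iff hd, exists_and_right, exists_eq',
    true_and]

lemma isEigenvectorWith_one_powerSum_iff (hd : 1 ≤ d) (α : Idx n r → ℂ) :
    IsEigenvectorWith d (powerSum n d r α) (X 0) 1 ↔
      eval α (gZero n d r) = 0 ∧ ∀ j, eval α (g n d r j) = 0 := by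
  rw [isEigenvectorWith_powerSum_iff hd, add_eq_left]

end BombieriWeyl

/-! ### Projective zero loci and vanishing ideals -/

section Projective

variable {σ : Type*}

lemma forall_mem_span_eval_eq_zero_iff {G : Set (MvPolynomial σ ℂ)} {v : σ → ℂ} :
    (∀ f ∈ Ideal.span G, eval v f = 0) ↔ ∀ f ∈ G, eval v f = 0 := by
  simpa [SetLike.le_def, Set.subset_def, RingHom.mem_ker] using
    Ideal.span_le (s := G) (I := RingHom.ker (eval v))

lemma eval_smul_of_isHomogeneous {f : MvPolynomial σ ℂ} {k : ℕ} (hf : f.IsHomogeneous k) (c : ℂ)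
    (v : σ → ℂ) : eval (c • v) f = c ^ k * eval v f := by
  rw [eval_eq, eval_eq, Finset.mul_sum]
  refine Finset.sum_congr rfl fun s hs => ?_
  have hk : s.degree = k := by
    rw [Finsupp.degree_eq_weight_one]; exact hf (mem_support_iff.1 hs)
  simp only [Pi.smul_apply, smul_eq_mul, mul_pow, Finset.prod_mul_distrib]
  rw [Finset.prod_pow_eq_pow_sum, ← Finsupp.degree_apply, hk]
  ring

/-- A polynomial which vanishes on a punctured line through the origin vanishes at the origin. -/
lemma eval_zero_of_forall_eval_smul {f : MvPolynomial σ ℂ} {v : σ → ℂ}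
    (h : ∀ t : ℂ, t ≠ 0 → eval (t • v) f = 0) : eval 0 f = 0 := by
  set q : Polynomial ℂ := aeval (fun i => Polynomial.C (v i) * Polynomial.X) f
  have hq : ∀ t, q.eval t = eval (t • v) f := by
    intro t
    have : (Polynomial.evalRingHom t).comp
        (aeval (fun i => Polynomial.C (v i) * Polynomial.X) : MvPolynomial σ ℂ →ₐ[ℂ] _).toRingHom =
        eval (t • v) :=
      ringHom_ext (fun a => by simp) fun i => by simpa using mul_comm _ _
    exact RingHom.congr_fun this f
  have hq0 : q = 0 := by
    refine Polynomial.eq_zero_of_infinite_isRoot q ?_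
    refine (Set.finite_singleton (0 : ℂ)).infinite_compl.mono fun t ht => ?_
    exact (hq t).trans (h t ht)
  rw [← zero_smul ℂ v, ← hq, hq0, Polynomial.eval_zero]

/-- The homogeneous Nullstellensatz, for equations with a nontrivial common zero. -/
lemma projVanishingIdeal_projZeroLocus [Finite σ] {G : Set (MvPolynomial σ ℂ)}
    (hG : ∀ f ∈ G, ∃ k, f.IsHomogeneous k) {v₀ : σ → ℂ} (hv₀ : v₀ ≠ 0)
    (hz : ∀ f ∈ G, eval v₀ f = 0) :
    projVanishingIdeal (projZeroLocus (Ideal.span G)) = (Ideal.span G).radical := by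
  have hmem : ∀ (v : σ → ℂ) (hv : v ≠ 0),
      Projectivization.mk ℂ v hv ∈ projZeroLocus (Ideal.span G) ↔ ∀ f ∈ G, eval v f = 0 := by
    intro v hv
    obtain ⟨a, ha⟩ := Projectivization.exists_smul_eq_mk_rep ℂ v hv
    simp only [projZeroLocus, Set.mem_ofPred_eq, forall_mem_span_eval_eq_zero_iff]
    refine forall₂_congr fun f hf => ?_
    obtain ⟨k, hk⟩ := hG f hf
    rw [← ha, Units.smul_def, eval_smul_of_isHomogeneous hk]
    simp
  rw [← vanishingIdeal_zeroLocus_eq_radical (K := ℂ), zeroLocus_span]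
  ext p
  simp only [projVanishingIdeal, mem_vanishingIdeal_iff, Set.mem_ofPred_eq, hmem,
    forall_exists_index]
  refine ⟨fun h v hv => ?_, fun h v _ hv => h v hv⟩
  by_cases hv0 : v = 0
  · subst hv0
    refine eval_zero_of_forall_eval_smul (v := v₀) fun t ht => ?_
    refine h _ (smul_ne_zero ht hv₀) fun f hf => ?_
    obtain ⟨k, hk⟩ := hG f hf
    rw [eval_smul_of_isHomogeneous hk, hz f hf, mul_zero]
  · exact h v hv0 hv

lemma height_radical {R : Type*} [CommRing R] (I : Ideal R) : I.radical.height = I.height := by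
  rw [Ideal.height_eq_inf_minimalPrimes, Ideal.height_eq_inf_minimalPrimes,
    Ideal.radical_minimalPrimes]

end Projective

/-! ### The equations of the two loci -/

section Equations

variable {n d r : ℕ}

lemma isHomogeneous_g (hd : 1 ≤ d) (j : Fin n) : (g n d r j).IsHomogeneous d := by
  refine IsHomogeneous.sum _ _ _ fun i _ => ?_
  have := (isHomogeneous_X_pow (R := ℂ) ((i, 0) : Idx n r) (d - 1)).mul
    (isHomogeneous_X ℂ ((i, j.succ) : Idx n r))
  rwa [Nat.sub_add_cancel hd] at this

lemma isHomogeneous_gZero : (gZero n d r).IsHomogeneous d :=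
  IsHomogeneous.sum _ _ _ fun _ _ => isHomogeneous_X_pow _ _

lemma eigenLocus_eq (hd : 1 ≤ d) :
    eigenLocus n d r = projZeroLocus (eigenIdeal n d r) := by
  ext p
  simp [eigenLocus, projZeroLocus, eigenIdeal, isEigenvector_powerSum_iff hd,
    forall_mem_span_eval_eq_zero_iff]

lemma singularLocus_eq (hd : 1 ≤ d) :
    singularLocus n d r = projZeroLocus (singularIdeal n d r) := by
  ext p
  simp [singularLocus, projZeroLocus, singularIdeal, isEigenvectorWith_one_powerSum_iff hd,
    forall_mem_span_eval_eq_zero_iff]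

/-- The equations vanish where all the `α_{i,0}` do. -/
lemma exists_common_zero (hn : 1 ≤ n) (hd : 2 ≤ d) (hr : 2 ≤ r) :
    ∃ v : Idx n r → ℂ, v ≠ 0 ∧ eval v (gZero n d r) = 0 ∧ ∀ j, eval v (g n d r j) = 0 := by
  refine ⟨fun p => if p.2 = 0 then 0 else 1, fun h => ?_, ?_, fun j => ?_⟩
  · have := congrFun h (⟨0, by lia⟩, ⟨1, by lia⟩)
    simp [Fin.ext_iff] at this
  · simp [gZero, show d ≠ 0 by lia]
  · simp [g, show d - 1 ≠ 0 by lia]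

lemma projVanishingIdeal_eigenLocus (hn : 1 ≤ n) (hd : 2 ≤ d) (hr : 2 ≤ r) :
    projVanishingIdeal (eigenLocus n d r) = (eigenIdeal n d r).radical := by
  obtain ⟨v, hv, -, hg⟩ := exists_common_zero hn hd hr
  rw [eigenLocus_eq (by lia)]
  refine projVanishingIdeal_projZeroLocus ?_ hv ?_
  · rintro _ ⟨j, rfl⟩; exact ⟨d, isHomogeneous_g (by lia) j⟩
  · rintro _ ⟨j, rfl⟩; exact hg j

lemma projVanishingIdeal_singularLocus (hn : 1 ≤ n) (hd : 2 ≤ d) (hr : 2 ≤ r) :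
    projVanishingIdeal (singularLocus n d r) = (singularIdeal n d r).radical := by
  obtain ⟨v, hv, h0, hg⟩ := exists_common_zero hn hd hr
  rw [singularLocus_eq (by lia)]
  refine projVanishingIdeal_projZeroLocus ?_ hv ?_
  · rintro _ (rfl | ⟨j, rfl⟩)
    exacts [⟨d, isHomogeneous_gZero⟩, ⟨d, isHomogeneous_g (by lia) j⟩]
  · rintro _ (rfl | ⟨j, rfl⟩)
    exacts [h0, hg j]

/-- The weight for which `α_{j-1,0}^(d-1) α_{j-1,j}`, in the numbering of the rows from `0`, is the
leading monomial of `g_j`, and `α_{n,0}^d` is that of the additional equation. -/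
def leadWeight (n d r : ℕ) (p : Idx n r) : ℕ :=
  if p.2 = 0 then (if p.1.val = n then 1 else 0) else (if p.2.val = p.1.val + 1 then d else 0)

/-- The exponent of the monomial `α_{i,0}^(d-1) α_{i,j}`. -/
noncomputable def rowExponent (d : ℕ) (i : Fin (r - 1)) (j : Fin n) : Idx n r →₀ ℕ :=
  Finsupp.single (i, 0) (d - 1) + Finsupp.single (i, j.succ) 1

lemma hasLead_sum_monomial {σ ι : Type*} [Fintype ι] {w : σ → ℕ} {a : ι → σ →₀ ℕ} {i₀ : ι}
    (h : ∀ i, i ≠ i₀ → Finsupp.weight w (a i) < Finsupp.weight w (a i₀)) :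
    HasLead w (a i₀) (∑ i, monomial (a i) (1 : ℂ)) := by
  classical
  rw [HasLead, Fintype.sum_eq_add_sum_subtype_ne _ i₀, add_sub_cancel_left]
  refine Submodule.sum_mem _ fun i _ => ?_
  rw [monomial_mem_restrictSupport]
  exact Or.inl (h i i.2)

lemma g_eq_sum_monomial (j : Fin n) :
    g n d r j = ∑ i, monomial (rowExponent d i j) (1 : ℂ) := by
  refine Finset.sum_congr rfl fun i _ => ?_
  rw [X_pow_eq_monomial, X, monomial_mul, one_mul, rowExponent]

lemma gZero_eq_sum_monomial :
    gZero n d r = ∑ i, monomial (Finsupp.single ((i, 0) : Idx n r) d) (1 : ℂ) :=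
  Finset.sum_congr rfl fun _ _ => X_pow_eq_monomial

lemma weight_rowExponent (i : Fin (r - 1)) (j : Fin n) :
    Finsupp.weight (leadWeight n d r) (rowExponent d i j) =
      (d - 1) * (if i.val = n then 1 else 0) + if j.val = i.val then d else 0 := by
  rw [rowExponent, map_add, Finsupp.weight_single, Finsupp.weight_single]
  simp [leadWeight]

lemma hasLead_g (hd : 1 ≤ d) {i : Fin (r - 1)} {j : Fin n} (hij : i.val = j.val) :
    HasLead (leadWeight n d r) (rowExponent d i j) (g n d r j) := by
  rw [g_eq_sum_monomial]
  refine hasLead_sum_monomial (a := fun i => rowExponent d i j) fun k hk => ?_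
  have hk' : k.val ≠ i.val := fun h => hk (Fin.ext h)
  rw [weight_rowExponent, weight_rowExponent, if_neg (show ¬ j.val = k.val by lia),
    if_neg (show ¬ i.val = n by lia), if_pos hij.symm]
  split_ifs <;> lia

lemma hasLead_gZero (hd : 1 ≤ d) {i : Fin (r - 1)} (hi : i.val = n) :
    HasLead (leadWeight n d r) (Finsupp.single (i, 0) d) (gZero n d r) := by
  rw [gZero_eq_sum_monomial]
  refine hasLead_sum_monomial (a := fun i => Finsupp.single ((i, 0) : Idx n r) d) fun k hk => ?_
  have hk' : k.val ≠ n := fun h => hk (Fin.ext (h.trans hi.symm))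
  simp only [Finsupp.weight_single, leadWeight, if_true, if_pos hi, if_neg hk']
  simpa using Nat.pos_of_ne_zero (show d ≠ 0 by lia)

lemma fst_eq_of_mem_support_rowExponent {i : Fin (r - 1)} {j : Fin n} {p : Idx n r}
    (hp : p ∈ (rowExponent d i j).support) : p.1 = i := by
  classical
  rcases Finset.mem_union.1 (Finsupp.support_add hp) with h | h <;>
    exact congrArg Prod.fst (Finset.mem_singleton.1 (Finsupp.support_single_subset h))

lemma degree_rowExponent (hd : 1 ≤ d) (i : Fin (r - 1)) (j : Fin n) :
    (rowExponent d i j).degree = d := by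
  rw [rowExponent, map_add, Finsupp.degree_single, Finsupp.degree_single, Nat.sub_add_cancel hd]

lemma coprimeLeads_g (hd : 1 ≤ d) (hr : n ≤ r - 1) :
    CoprimeLeads (leadWeight n d r) (fun j : Fin n => rowExponent d (Fin.castLE hr j) j)
      (g n d r) where
  ne_zero j h0 := by
    have := degree_rowExponent hd (Fin.castLE hr j) j
    rw [h0, map_zero] at this
    lia
  disjoint j l hjl := Finset.disjoint_left.2 fun p hp hp' => hjl <| by
    have := (fst_eq_of_mem_support_rowExponent hp).symm.trans
      (fst_eq_of_mem_support_rowExponent hp')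
    exact Fin.castLE_injective hr this
  hasLead j := hasLead_g hd rfl

/-- The leading exponents of the equations of the locus with singular value `1`. -/
noncomputable def singularExponent (d : ℕ) (hr : n + 1 ≤ r - 1) (o : Option (Fin n)) :
    Idx n r →₀ ℕ :=
  o.elim (Finsupp.single (⟨n, hr⟩, 0) d)
    fun j => rowExponent d (Fin.castLE (Nat.le_of_succ_le hr) j) j

/-- The equations of the locus with singular value `1`, as a family. -/
noncomputable def singularEquation (n d r : ℕ) (o : Option (Fin n)) : MvPolynomial (Idx n r) ℂ :=
  o.elim (gZero n d r) (g n d r)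

lemma singularIdeal_eq : singularIdeal n d r = Ideal.span (Set.range (singularEquation n d r)) := by
  rw [Option.range_eq]; rfl

lemma fst_eq_of_mem_support_singularExponent {hr : n + 1 ≤ r - 1} {o : Option (Fin n)}
    {p : Idx n r} (hp : p ∈ (singularExponent d hr o).support) :
    p.1.val = o.elim n Fin.val := by
  cases o with
  | none =>
    have := Finset.mem_singleton.1 (Finsupp.support_single_subset hp)
    rw [this]; rfl
  | some j => rw [fst_eq_of_mem_support_rowExponent hp]; rfl

lemma degree_singularExponent (hd : 1 ≤ d) (hr : n + 1 ≤ r - 1) (o : Option (Fin n)) :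
    (singularExponent d hr o).degree = d := by
  cases o with
  | none => exact Finsupp.degree_single _ _
  | some j => exact degree_rowExponent hd _ j

lemma isHomogeneous_singularEquation (hd : 1 ≤ d) (o : Option (Fin n)) :
    (singularEquation n d r o).IsHomogeneous d := by
  cases o with
  | none => exact isHomogeneous_gZero
  | some j => exact isHomogeneous_g hd j

lemma coprimeLeads_singularEquation (hd : 1 ≤ d) (hr : n + 1 ≤ r - 1) :
    CoprimeLeads (leadWeight n d r) (singularExponent d hr) (singularEquation n d r) where
  ne_zero o h0 := by
    have := degree_singularExponent hd hr o
    rw [h0, map_zero] at this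
    lia
  disjoint o o' ho := Finset.disjoint_left.2 fun p hp hp' => ho <| by
    have := (fst_eq_of_mem_support_singularExponent hp).symm.trans
      (fst_eq_of_mem_support_singularExponent hp')
    rcases o with _ | j <;> rcases o' with _ | j' <;> simp only [Option.elim] at this
    · rfl
    · exact absurd this j'.2.ne'
    · exact absurd this j.2.ne
    · rw [Fin.ext this]
  hasLead o := by
    cases o with
    | none => exact hasLead_gZero hd rfl
    | some j => exact hasLead_g hd rfl

/-! ### Codimension, degree and irreducibility of the two loci -/

lemma codim_eigenLocus (hn : 1 ≤ n) (hd : 2 ≤ d) (hr : n + 1 ≤ r) :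
    codim (eigenLocus n d r) = n := by
  have h := (coprimeLeads_g (n := n) (d := d) (r := r) (by lia) (by lia)).height_span Finset.univ
  rw [codim, projVanishingIdeal_eigenLocus hn hd (by lia), height_radical, eigenIdeal,
    ← Set.image_univ, ← Finset.coe_univ, h, Finset.card_univ, Fintype.card_fin]

lemma hasDegree_eigenIdeal (hn : 1 ≤ n) (hd : 2 ≤ d) (hr : n + 1 ≤ r) :
    HasDegree (eigenIdeal n d r) (d ^ n) := by
  have h := (coprimeLeads_g (n := n) (d := d) (r := r) (by lia) (by lia)).hasDegree_span
    (d := d) (by lia) (fun j => degree_rowExponent (by lia) _ j)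
    (fun j => isHomogeneous_g (by lia) j) (by
      simp only [Fintype.card_prod, Fintype.card_fin]
      exact Nat.le_mul_of_pos_left _ (by lia))
  rwa [Fintype.card_fin] at h

/-- The row numbered `n` meets none of the leading monomials. -/
lemma isPrime_eigenIdeal (hd : 2 ≤ d) (hr : n + 2 ≤ r) : (eigenIdeal n d r).IsPrime := by
  have h := coprimeLeads_g (n := n) (d := d) (r := r) (by lia) (by lia)
  have hI : eigenIdeal n d r = Ideal.span (g n d r '' Set.univ) := by
    rw [Set.image_univ, eigenIdeal]
  refine isPrime_of_X_mul_mem ⊥ (by rw [Ideal.map_bot, bot_sup_eq]) (hI ▸ h.span_ne_top _)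
    ⟨n, by lia⟩ fun p hp => ?_
  rw [hI] at hp ⊢
  refine h.mem_span_of_X_mul_mem (fun j hj => ?_) hp
  exact absurd (congrArg Fin.val (fst_eq_of_mem_support_rowExponent hj)) j.2.ne'

lemma codim_singularLocus (hn : 1 ≤ n) (hd : 2 ≤ d) (hr : n + 2 ≤ r) :
    codim (singularLocus n d r) = n + 1 := by
  have h := (coprimeLeads_singularEquation (n := n) (d := d) (r := r) (by lia)
    (by lia)).height_span Finset.univ
  rw [codim, projVanishingIdeal_singularLocus hn hd (by lia), height_radical, singularIdeal_eq,
    ← Set.image_univ, ← Finset.coe_univ, h, Finset.card_univ, Fintype.card_option,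
    Fintype.card_fin, Nat.cast_succ]

lemma hasDegree_singularIdeal (hn : 1 ≤ n) (hd : 2 ≤ d) (hr : n + 2 ≤ r) :
    HasDegree (singularIdeal n d r) (d ^ (n + 1)) := by
  have h := (coprimeLeads_singularEquation (n := n) (d := d) (r := r) (by lia)
    (by lia)).hasDegree_span (d := d) (by lia) (fun o => degree_singularExponent (by lia) _ o)
    (fun o => isHomogeneous_singularEquation (by lia) o) (by
      simp only [Fintype.card_prod, Fintype.card_fin, Fintype.card_option]
      calc n + 1 + 1 ≤ 2 * (n + 1) := by lia
        _ ≤ (r - 1) * (n + 1) := Nat.mul_le_mul_right _ (by lia))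
  rwa [Fintype.card_option, Fintype.card_fin, ← singularIdeal_eq] at h

/-- The row numbered `n + 1` meets none of the leading monomials. -/
lemma isPrime_singularIdeal (hn : 1 ≤ n) (hd : 2 ≤ d) (hr : n + 3 ≤ r) :
    (singularIdeal n d r).IsPrime := by
  have h := coprimeLeads_singularEquation (n := n) (d := d) (r := r) (by lia) (by lia)
  have hI : singularIdeal n d r = Ideal.span (singularEquation n d r '' Set.univ) := by
    rw [Set.image_univ, singularIdeal_eq]
  have hF := prime_sum_X_pow (m := r - 1) (d := d) (by lia) hd
  have := (Ideal.span_singleton_prime hF.ne_zero).2 hF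
  refine isPrime_of_X_mul_mem (d := d) (Ideal.span {∑ i : Fin (r - 1), X i ^ d}) ?_
    (hI ▸ h.span_ne_top _) ⟨n + 1, by lia⟩ fun p hp => ?_
  · rw [Ideal.map_span, Set.image_singleton, singularIdeal, Ideal.span_insert, eigenIdeal, gZero]
    simp
  · rw [hI] at hp ⊢
    refine h.mem_span_of_X_mul_mem (fun o ho => ?_) hp
    have := fst_eq_of_mem_support_singularExponent ho
    rcases o with _ | j <;> simp only [Option.elim] at this
    · lia
    · exact absurd this (by have := j.2; lia)

lemma g_ne_zero (hr : 2 ≤ r) (j : Fin n) : g n d r j ≠ 0 := by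
  intro h
  have := congrArg (eval fun _ => (1 : ℂ)) h
  simp only [g, map_sum, map_mul, map_pow, eval_X, one_pow, mul_one, Finset.sum_const,
    Finset.card_univ, Fintype.card_fin, nsmul_eq_mul, map_zero, Nat.cast_eq_zero] at this
  lia

end Equations

end CriticalWaring

theorem mainTheorem9 (n d r : ℕ) (hn : 1 ≤ n) (hd : 2 ≤ d) (hr : 2 ≤ r) :
    -- the equations of the two loci, for every choice of representatives
    ((∀ α : CriticalWaring.Idx n r → ℂ,
        CriticalWaring.IsEigenvector d (CriticalWaring.powerSum n d r α) (MvPolynomial.X 0) ↔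
          ∀ j, MvPolynomial.eval α (CriticalWaring.g n d r j) = 0) ∧
      CriticalWaring.eigenLocus n d r =
        CriticalWaring.projZeroLocus (CriticalWaring.eigenIdeal n d r) ∧
      (∀ α : CriticalWaring.Idx n r → ℂ,
        CriticalWaring.IsEigenvectorWith d (CriticalWaring.powerSum n d r α)
            (MvPolynomial.X 0) 1 ↔
          MvPolynomial.eval α (CriticalWaring.gZero n d r) = 0 ∧
            ∀ j, MvPolynomial.eval α (CriticalWaring.g n d r j) = 0) ∧
      CriticalWaring.singularLocus n d r =
        CriticalWaring.projZeroLocus (CriticalWaring.singularIdeal n d r)) ∧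
    -- codimension and degree of the locus where `x_0` is an eigenvector
    (n + 1 ≤ r →
      CriticalWaring.codim (CriticalWaring.eigenLocus n d r) = (n : ℕ∞) ∧
      CriticalWaring.HasDegree (CriticalWaring.eigenIdeal n d r) (d ^ n)) ∧
    -- if `r ≥ n + 2` it is irreducible, and the equations generate its ideal
    (n + 2 ≤ r →
      (CriticalWaring.eigenIdeal n d r).IsPrime ∧
      CriticalWaring.projVanishingIdeal (CriticalWaring.eigenLocus n d r) =
        CriticalWaring.eigenIdeal n d r) ∧
    -- for `n = 1` it is a hypersurface of degree `d`
    (n = 1 → ∃ f : MvPolynomial (CriticalWaring.Idx n r) ℂ, f ≠ 0 ∧ f.IsHomogeneous d ∧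
      CriticalWaring.eigenIdeal n d r = Ideal.span {f} ∧
      CriticalWaring.eigenLocus n d r = CriticalWaring.projZeroLocus (Ideal.span {f}) ∧
      CriticalWaring.codim (CriticalWaring.eigenLocus n d r) = 1 ∧
      CriticalWaring.HasDegree (CriticalWaring.eigenIdeal n d r) d) ∧
    -- codimension and degree of the locus where `x_0` has singular value `1`
    (n + 2 ≤ r →
      CriticalWaring.codim (CriticalWaring.singularLocus n d r) = (n : ℕ∞) + 1 ∧
      CriticalWaring.HasDegree (CriticalWaring.singularIdeal n d r) (d ^ (n + 1))) ∧
    -- if `r ≥ n + 3` it is irreducible, and the equations generate its ideal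
    (n + 3 ≤ r →
      (CriticalWaring.singularIdeal n d r).IsPrime ∧
      CriticalWaring.projVanishingIdeal (CriticalWaring.singularLocus n d r) =
        CriticalWaring.singularIdeal n d r) := by
  open CriticalWaring in
  have hd1 : 1 ≤ d := by lia
  refine ⟨⟨isEigenvector_powerSum_iff hd1, eigenLocus_eq hd1,
    isEigenvectorWith_one_powerSum_iff hd1, singularLocus_eq hd1⟩,
    fun h => ⟨codim_eigenLocus hn hd h, hasDegree_eigenIdeal hn hd h⟩, fun h => ?_, fun h1 => ?_,
    fun h => ⟨codim_singularLocus hn hd h, hasDegree_singularIdeal hn hd h⟩, fun h => ?_⟩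
  · have hp := isPrime_eigenIdeal hd h
    exact ⟨hp, by rw [projVanishingIdeal_eigenLocus hn hd hr, hp.radical]⟩
  · subst h1
    have hspan : eigenIdeal 1 d r = Ideal.span {g 1 d r 0} := by
      rw [eigenIdeal, Set.range_unique]; rfl
    refine ⟨g 1 d r 0, g_ne_zero hr 0, isHomogeneous_g hd1 0, hspan, ?_, ?_, ?_⟩
    · rw [eigenLocus_eq hd1, hspan]
    · exact_mod_cast codim_eigenLocus le_rfl hd hr
    · simpa using hasDegree_eigenIdeal le_rfl hd hr
  · have hp := isPrime_singularIdeal hn hd h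
    exact ⟨hp, by rw [projVanishingIdeal_singularLocus hn hd hr, hp.radical]⟩
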